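/- For an integer $r\geq 1$, let $BF(r)$ be the butterfly network: the simple graph with vertices $(x,i)$, $x\in\{0,1\}^r$, $0\leq i\leq r$, whose edges are the pairs $\{(x,i-1),(y,i)\}$ with $1\leq i\leq r$ and $y\in\{x,\,x+e_i\}$, where addition is modulo $2$ and $e_i$ is the $i$-th unit vector. For a field $F$ and a simple graph $G$ on a finite vertex set $V$, let $\operatorname{mr}^F(G)$ be the minimum rank of a symmetric matrix $A\in F^{V\times V}$ such that, for all $u\neq v$ in $V$, $a_{uv}\neq 0$ if and only if $uv$ is an edge of $G$ (the diagonal entries are arbitrary). A set $S\subseteq V$ is zero-forcing if, starting with exactly the vertices of $S$ colored, all vertices can be colored by repeatedly applying the rule that an uncolored vertex becomes colored if it is the only uncolored neighbor of some colored vertex; $Z(G)$ is the minimum cardinality of a zero-forcing set. Then for every $r\geq 1$ and every field $F$, \[\operatorname{mr}^F(BF(r))=\frac29\left[(3r+1)2^r-(-1)^r\right],\] and this equals the rank over $F$ of the adjacency matrix of $BF(r)$. Furthermore, equality holds for $BF(r)$ in the general bound $\operatorname{mr}^F(G)\geq |V(G)|-Z(G)$, that is, \[Z(BF(r))=(r+1)2^r-\operatorname{mr}^F(BF(r))=\frac19\left[(3r+7)2^r+2(-1)^r\right].\]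 -/

import Mathlib

/-- `S(F, G)`: the symmetric matrices over `F`, indexed by the vertices of `G`, whose nonzero
off-diagonal entries are exactly those at the edges of `G` (the diagonal is arbitrary). -/
def graphMatrices (F : Type*) [Field F] {V : Type*} (G : SimpleGraph V) : Set (Matrix V V F) :=
  {A | A.IsSymm ∧ ∀ i j, i ≠ j → (G.Adj i j ↔ A i j ≠ 0)}

/-- The minimum `F`-rank of a finite graph. The set is nonempty, as `minRank_isLeast` shows. -/
noncomputable def minRank (F : Type*) [Field F] {V : Type*} [Fintype V] (G : SimpleGraph V) : ℕ :=
  sInf {k | ∃ A ∈ graphMatrices F G, A.rank = k}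

/-- One application of the coloring rule: `v` is the only uncolored neighbor of some colored
vertex `u`, and gets colored. -/
def ForcingStep {V : Type*} [DecidableEq V] (G : SimpleGraph V) (S T : Finset V) : Prop :=
  ∃ u ∈ S, ∃ v ∉ S, G.Adj u v ∧ (∀ w ∉ S, G.Adj u w → w = v) ∧ T = insert v S

/-- `S` is zero-forcing if repeated application of the coloring rule can color all vertices. -/
def IsZeroForcing {V : Type*} [Fintype V] [DecidableEq V] (G : SimpleGraph V) (S : Finset V) :
    Prop :=
  Relation.ReflTransGen (ForcingStep G) S Finset.univ

/-- The minimum cardinality of a zero-forcing set. -/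
noncomputable def zeroForcingNumber {V : Type*} [Fintype V] [DecidableEq V] (G : SimpleGraph V) :
    ℕ :=
  sInf {k | ∃ S : Finset V, IsZeroForcing G S ∧ S.card = k}

theorem adjMatrix_mem_graphMatrices (F : Type*) [Field F] {V : Type*} (G : SimpleGraph V)
    [DecidableRel G.Adj] : G.adjMatrix F ∈ graphMatrices F G := by
  refine ⟨G.isSymm_adjMatrix, fun i j _ => ?_⟩
  by_cases h : G.Adj i j <;> simp [SimpleGraph.adjMatrix_apply, h]

theorem minRank_isLeast (F : Type*) [Field F] {V : Type*} [Fintype V] (G : SimpleGraph V) :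
    IsLeast {k | ∃ A ∈ graphMatrices F G, A.rank = k} (minRank F G) := by
  classical
  exact ⟨Nat.sInf_mem ⟨_, G.adjMatrix F, adjMatrix_mem_graphMatrices F G, rfl⟩,
    fun _ h => Nat.sInf_le h⟩

theorem zeroForcingNumber_isLeast {V : Type*} [Fintype V] [DecidableEq V] (G : SimpleGraph V) :
    IsLeast {k | ∃ S : Finset V, IsZeroForcing G S ∧ S.card = k} (zeroForcingNumber G) :=
  ⟨Nat.sInf_mem ⟨_, Finset.univ, Relation.ReflTransGen.refl, rfl⟩, fun _ h => Nat.sInf_le h⟩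

/-- Vertices `(x, i)` of the butterfly network, with `x ∈ {0,1}^r` and level `i ∈ {0, …, r}`.
Addition in `ZMod 2` is addition modulo 2. -/
abbrev ButterflyVertex (r : ℕ) : Type := (Fin r → ZMod 2) × Fin (r + 1)

/-- `p = (x, k)` and `q = (y, k + 1)` with `y = x` or `y = x + e`, where `e` is the unit vector in
the `(k + 1)`-st position, which has the index `k` in `Fin r`. -/
def ButterflyUp (r : ℕ) (p q : ButterflyVertex r) : Prop :=
  ∃ k : Fin r, p.2 = k.castSucc ∧ q.2 = k.succ ∧ (q.1 = p.1 ∨ q.1 = p.1 + Pi.single k 1)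

instance (r : ℕ) : DecidableRel (ButterflyUp r) := fun p q => by
  unfold ButterflyUp; infer_instance

/-- The butterfly network `BF(r)`. -/
def butterfly (r : ℕ) : SimpleGraph (ButterflyVertex r) where
  Adj p q := ButterflyUp r p q ∨ ButterflyUp r q p
  symm := ⟨fun _ _ h => h.symm⟩
  loopless := ⟨fun p h => by
    rcases h with ⟨k, h1, h2, _⟩ | ⟨k, h1, h2, _⟩ <;>
      exact absurd (h1.symm.trans h2) (Fin.castSucc_lt_succ (i := k)).ne⟩

instance (r : ℕ) : DecidableRel (butterfly r).Adj := fun p q =>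
  inferInstanceAs (Decidable (ButterflyUp r p q ∨ ButterflyUp r q p))

/-! Let `A` be the adjacency matrix. It suffices to find one zero-forcing set `S` such that every
function on `S` extends to a vector in the kernel of `A`. Extension gives rank `A` ≤ |V| - |S|
(`rank_add_card_le`), zero forcing gives |V| - Z ≤ mr (`card_le_zeroForcingNumber_add_minRank`), and
with Z ≤ |S| and mr ≤ rank `A` all of these become equalities, over any field.

Such an `S` is built by recursion. The butterfly with levels 0, …, r + 1 consists of two butterflies
with levels 0, …, r and a new top level; the vertices (x, r) and (x + e, r), one in each half, have
the same two upper neighbors. Three spaces are treated together: L (equations of level r dropped), K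
(the kernel), O (kernel vectors vanishing on level r). A vector f on one half is copied to the other
half with alternating signs (`twist`), which makes the equations of levels r and r + 1 compatible.
The remaining freedom is a vector g on the other half and half of the new level. This gives L' = L +
K + 2^r, K' = L + O + 2^r, O' = K + O for the sizes. Forcing obeys the same recursion when the three
seeds may assume nothing, `UpperColored` and `TopColored` respectively. `IsSeed` couples forcing and
extension, and `exists_isSeed` runs the induction; K at r = n yields `S`. -/

/-! ### Zero forcing and the kernel of a graph matrix -/

/-- A set of vertices is forcing-closed if the coloring rule adds no vertex to it. -/
def ForcingClosed {V : Type*} (G : SimpleGraph V) (C : Set V) : Prop :=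
  ∀ u ∈ C, ∀ v, G.Adj u v → (∀ w, G.Adj u w → w ≠ v → w ∈ C) → v ∈ C

theorem subset_of_reachable {V : Type*} [DecidableEq V] {G : SimpleGraph V} {S T : Finset V}
    (h : Relation.ReflTransGen (ForcingStep G) S T) : S ⊆ T := by
  induction h with
  | refl => exact Finset.Subset.refl _
  | tail _ hstep ih =>
    obtain ⟨u, -, v, -, -, -, rfl⟩ := hstep
    exact ih.trans (Finset.subset_insert _ _)

/-- A set is zero-forcing as soon as no proper forcing-closed set contains it. -/
theorem isZeroForcing_of_closed {V : Type*} [Fintype V] [DecidableEq V] {G : SimpleGraph V}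
    {S : Finset V} (h : ∀ C : Set V, ForcingClosed G C → (∀ v ∈ S, v ∈ C) → ∀ v, v ∈ C) :
    IsZeroForcing G S := by
  classical
  -- A reachable set of maximal size admits no further force, so it is forcing-closed.
  obtain ⟨C, hC, hmax⟩ := Finset.exists_max_image
    (Finset.univ.filter fun T => Relation.ReflTransGen (ForcingStep G) S T) Finset.card
    ⟨S, by simp [Relation.ReflTransGen.refl]⟩
  simp only [Finset.mem_filter, Finset.mem_univ, true_and] at hC hmax
  have hclosed : ForcingClosed G (C : Set V) := by
    intro u hu v huv hw
    by_contra hv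
    have hstep : ForcingStep G C (insert v C) :=
      ⟨u, hu, v, hv, huv, fun w hwC hadj => by_contra fun hne => hwC (hw w hadj hne), rfl⟩
    have := hmax _ (hC.tail hstep)
    rw [Finset.card_insert_of_notMem hv] at this
    omega
  have : C = Finset.univ := Finset.eq_univ_iff_forall.2
    fun v => h C hclosed (fun v hv => subset_of_reachable hC hv) v
  rw [this] at hC
  exact hC

/-- When `u` forces `v`, all terms of row `u` of `A f = 0` except `a_uv f_v` vanish, the diagonal
term because `u` is itself colored; and `a_uv ≠ 0`. -/
theorem eq_zero_of_reachable {F : Type*} [Field F] {V : Type*} [Fintype V] [DecidableEq V]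
    {G : SimpleGraph V} {A : Matrix V V F} (hA : A ∈ graphMatrices F G) {f : V → F}
    (hf : A.mulVec f = 0) {S T : Finset V} (h : Relation.ReflTransGen (ForcingStep G) S T)
    (hS : ∀ v ∈ S, f v = 0) : ∀ v ∈ T, f v = 0 := by
  induction h with
  | refl => exact hS
  | @tail T _ _ hstep ih =>
    obtain ⟨u, hu, v, hv, huv, huniq, rfl⟩ := hstep
    intro w hw
    rcases Finset.mem_insert.1 hw with rfl | hw
    · have hrow : ∑ x, A u x * f x = 0 := congrFun hf u
      rw [Finset.sum_eq_single w] at hrow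
      · exact (mul_eq_zero.1 hrow).resolve_left ((hA.2 u w huv.ne).1 huv)
      · intro x _ hxw
        by_cases hxS : x ∈ T
        · rw [ih x hxS, mul_zero]
        · have hux : u ≠ x := fun h => hxS (h ▸ hu)
          have : A u x = 0 := by
            by_contra hne
            exact hxw (huniq x hxS ((hA.2 u x hux).2 hne))
          rw [this, zero_mul]
      · simp
    · exact ih w hw

/-- The general bound `|V(G)| - Z(G) ≤ mr(G)`, for one matrix and one zero-forcing set. -/
theorem card_le_card_add_rank {F : Type*} [Field F] {V : Type*} [Fintype V] [DecidableEq V]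
    {G : SimpleGraph V} {A : Matrix V V F} (hA : A ∈ graphMatrices F G) {S : Finset V}
    (hS : IsZeroForcing G S) : Fintype.card V ≤ S.card + A.rank := by
  have hrn := A.mulVecLin.finrank_range_add_finrank_ker
  rw [Module.finrank_fintype_fun_eq_card] at hrn
  -- A kernel vector is determined by its restriction to `S`, so the nullity is at most `|S|`.
  have hinj : Function.Injective
      ((LinearMap.funLeft F F (Subtype.val : S → V)).comp (LinearMap.ker A.mulVecLin).subtype) := by
    rw [← LinearMap.ker_eq_bot, LinearMap.ker_eq_bot']
    rintro ⟨f, hf⟩ h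
    ext v
    exact eq_zero_of_reachable hA (by simpa using hf) hS
      (fun w hw => congrFun h ⟨w, hw⟩) v (Finset.mem_univ v)
  have := LinearMap.finrank_le_finrank_of_injective hinj
  rw [Module.finrank_fintype_fun_eq_card, Fintype.card_coe] at this
  unfold Matrix.rank
  omega

/-- If every function on `S` extends to a kernel vector of `A`, then `A` has nullity at least
`|S|`. -/
theorem rank_add_card_le {F : Type*} [Field F] {V : Type*} [Fintype V] [DecidableEq V]
    {A : Matrix V V F} {S : Finset V}
    (h : ∀ c : V → F, ∃ f : V → F, A.mulVec f = 0 ∧ ∀ v ∈ S, f v = c v) :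
    A.rank + S.card ≤ Fintype.card V := by
  have hrn := A.mulVecLin.finrank_range_add_finrank_ker
  rw [Module.finrank_fintype_fun_eq_card] at hrn
  have hsurj : Function.Surjective
      ((LinearMap.funLeft F F (Subtype.val : S → V)).comp (LinearMap.ker A.mulVecLin).subtype) := by
    intro c
    obtain ⟨f, hf, hfc⟩ := h fun v => if hv : v ∈ S then c ⟨v, hv⟩ else 0
    refine ⟨⟨f, by simpa using hf⟩, ?_⟩
    ext ⟨v, hv⟩
    simpa [hv] using hfc v hv
  have := LinearMap.finrank_le_finrank_of_surjective hsurj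
  rw [Module.finrank_fintype_fun_eq_card, Fintype.card_coe] at this
  unfold Matrix.rank
  omega

theorem zeroForcingNumber_le {V : Type*} [Fintype V] [DecidableEq V] {G : SimpleGraph V}
    {S : Finset V} (hS : IsZeroForcing G S) : zeroForcingNumber G ≤ S.card :=
  (zeroForcingNumber_isLeast G).2 ⟨S, hS, rfl⟩

theorem card_le_zeroForcingNumber_add_minRank (F : Type*) [Field F] {V : Type*} [Fintype V]
    [DecidableEq V] (G : SimpleGraph V) :
    Fintype.card V ≤ zeroForcingNumber G + minRank F G := by
  obtain ⟨A, hA, hrank⟩ := (minRank_isLeast F G).1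
  obtain ⟨S, hS, hcard⟩ := (zeroForcingNumber_isLeast G).1
  rw [← hrank, ← hcard]
  exact card_le_card_add_rank hA hS

/-! ### Subcubes -/

/-- The unit vector with entry one at index `i`; it is zero for `n ≤ i`. -/
def cubeUnit (n i : ℕ) : Fin n → ZMod 2 := fun j => if j.val = i then 1 else 0

/-- The words that agree with `z` at all indices from `r` on. -/
def subcube {n : ℕ} (r : ℕ) (z : Fin n → ZMod 2) : Finset (Fin n → ZMod 2) :=
  Finset.univ.filter fun x => ∀ j : Fin n, r ≤ j.val → x j = z j

theorem mem_subcube {n r : ℕ} {z x : Fin n → ZMod 2} :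
    x ∈ subcube r z ↔ ∀ j : Fin n, r ≤ j.val → x j = z j := by simp [subcube]

theorem mem_subcube_self {n r : ℕ} (z : Fin n → ZMod 2) : z ∈ subcube r z :=
  mem_subcube.2 fun _ _ => rfl

theorem add_cubeUnit_cancel {n : ℕ} (x : Fin n → ZMod 2) (i : ℕ) :
    x + cubeUnit n i + cubeUnit n i = x := by
  ext j
  simp [add_assoc, CharTwo.add_self_eq_zero]

theorem mem_subcube_add_cubeUnit_right {n r i : ℕ} {z x : Fin n → ZMod 2} :
    x ∈ subcube r (z + cubeUnit n i) ↔ x + cubeUnit n i ∈ subcube r z := by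
  simp only [mem_subcube]
  refine forall₂_congr fun j _ => ?_
  rw [Pi.add_apply, Pi.add_apply]
  constructor
  · rintro h; rw [h, add_assoc, CharTwo.add_self_eq_zero, add_zero]
  · rintro h; rw [← h, add_assoc, CharTwo.add_self_eq_zero, add_zero]

theorem add_cubeUnit_mem_subcube {n r i : ℕ} (hi : i < r) {z x : Fin n → ZMod 2} :
    x + cubeUnit n i ∈ subcube r z ↔ x ∈ subcube r z := by
  simp only [mem_subcube]
  refine forall₂_congr fun j hj => ?_
  have : j.val ≠ i := by omega
  simp [cubeUnit, this]

theorem mem_subcube_succ {n r : ℕ} (hr : r < n) {z x : Fin n → ZMod 2} :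
    x ∈ subcube (r + 1) z ↔ x ∈ subcube r z ∨ x + cubeUnit n r ∈ subcube r z := by
  simp only [mem_subcube]
  constructor
  · intro h
    have key : ∀ a b : ZMod 2, a = b ∨ a + 1 = b := by decide
    rcases key (x ⟨r, hr⟩) (z ⟨r, hr⟩) with h' | h'
    · left
      intro j hj
      rcases hj.eq_or_lt with hj | hj
      · have : j = ⟨r, hr⟩ := Fin.ext hj.symm
        rw [this, h']
      · exact h j hj
    · right
      intro j hj
      rcases hj.eq_or_lt with hj | hj
      · have : j = ⟨r, hr⟩ := Fin.ext hj.symm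
        subst this
        simpa [cubeUnit] using h'
      · have : j.val ≠ r := by omega
        simpa [cubeUnit, this] using h j hj
  · rintro (h | h) j hj
    · exact h j (by omega)
    · have : j.val ≠ r := by omega
      simpa [cubeUnit, this] using h j (by omega)

theorem add_cubeUnit_notMem_subcube {n r : ℕ} (hr : r < n) {z x : Fin n → ZMod 2}
    (hx : x ∈ subcube r z) : x + cubeUnit n r ∉ subcube r z := by
  intro h
  rw [mem_subcube] at hx h
  have h1 := hx ⟨r, hr⟩ le_rfl
  have h2 := h ⟨r, hr⟩ le_rfl
  rw [Pi.add_apply, h1] at h2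
  simp [cubeUnit] at h2

theorem subcube_zero {n : ℕ} (z : Fin n → ZMod 2) : subcube 0 z = {z} := by
  ext x
  simp [mem_subcube, funext_iff]

theorem mem_subcube_of_le {n r : ℕ} (hr : n ≤ r) (z x : Fin n → ZMod 2) : x ∈ subcube r z :=
  mem_subcube.2 fun j hj => absurd j.2 (by omega)

theorem card_subcube {n r : ℕ} (hr : r ≤ n) (z : Fin n → ZMod 2) :
    (subcube r z).card = 2 ^ r := by
  induction r generalizing z with
  | zero => simp [subcube_zero]
  | succ r ih =>
    have hunion : subcube (r + 1) z = subcube r z ∪ subcube r (z + cubeUnit n r) := by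
      ext x
      rw [Finset.mem_union, mem_subcube_succ hr, mem_subcube_add_cubeUnit_right]
    rw [hunion, Finset.card_union_of_disjoint, ih (by omega), ih (by omega), pow_succ, mul_two]
    rw [Finset.disjoint_left]
    intro x hx hx'
    exact add_cubeUnit_notMem_subcube hr hx (mem_subcube_add_cubeUnit_right.1 hx')

/-! ### Kernel equations, level by level

Functions on the vertices are written `f x i` with a natural number `i` as level; the butterfly
network of dimension `n` occupies the levels `0, …, n`. -/

/-- The sum of `f` over the neighbors of `(x, i)` on the level below. -/
def downSum {n : ℕ} {F : Type*} [Field F] (f : (Fin n → ZMod 2) → ℕ → F) (x : Fin n → ZMod 2) :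
    ℕ → F
  | 0 => 0
  | i + 1 => f x i + f (x + cubeUnit n i) i

/-- The sum of `f` over the neighbors of `(x, i)` on the level above. -/
def upSum {n : ℕ} {F : Type*} [Field F] (f : (Fin n → ZMod 2) → ℕ → F) (x : Fin n → ZMod 2)
    (i : ℕ) : F :=
  f x (i + 1) + f (x + cubeUnit n i) (i + 1)

theorem downSum_add {n : ℕ} {F : Type*} [Field F] (f g : (Fin n → ZMod 2) → ℕ → F)
    (x : Fin n → ZMod 2) (i : ℕ) : downSum (f + g) x i = downSum f x i + downSum g x i := by
  cases i with
  | zero => simp [downSum]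
  | succ i => simp only [downSum, Pi.add_apply]; ring

theorem upSum_add {n : ℕ} {F : Type*} [Field F] (f g : (Fin n → ZMod 2) → ℕ → F)
    (x : Fin n → ZMod 2) (i : ℕ) : upSum (f + g) x i = upSum f x i + upSum g x i := by
  simp only [upSum, Pi.add_apply]; ring

/-- `f` lives on the sub-butterfly with levels `0, …, r` through `z` and satisfies the kernel
equations of its levels below `r`. -/
structure IsOpenSolution {n : ℕ} {F : Type*} [Field F] (r : ℕ) (z : Fin n → ZMod 2)
    (f : (Fin n → ZMod 2) → ℕ → F) : Prop where
  eq_zero : ∀ x i, ¬ (x ∈ subcube r z ∧ i ≤ r) → f x i = 0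
  sum_eq_zero : ∀ x, ∀ i < r, downSum f x i + upSum f x i = 0

/-- `f` is a kernel vector of the sub-butterfly with levels `0, …, r` through `z`. -/
structure IsSolution {n : ℕ} {F : Type*} [Field F] (r : ℕ) (z : Fin n → ZMod 2)
    (f : (Fin n → ZMod 2) → ℕ → F) : Prop extends IsOpenSolution r z f where
  top_sum : ∀ x, downSum f x r = 0

/-- `f` is a kernel vector of the sub-butterfly that vanishes on the top level `r`. -/
structure IsZeroTopSolution {n : ℕ} {F : Type*} [Field F] (r : ℕ) (z : Fin n → ZMod 2)
    (f : (Fin n → ZMod 2) → ℕ → F) : Prop extends IsSolution r z f where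
  top_eq_zero : ∀ x, f x r = 0

/-! ### Gluing solutions on the two halves -/

/-- `f` carried over to the neighboring sub-butterfly, with signs that alternate by level. -/
def twist {n : ℕ} {F : Type*} [Field F] (r : ℕ) (f : (Fin n → ZMod 2) → ℕ → F) :
    (Fin n → ZMod 2) → ℕ → F :=
  fun x i => (-1) ^ (i + r + 1) * f (x + cubeUnit n r) i

/-- The levels `i - 1` and `i + 1` carry the same sign in `twist`, so the equation of level `i` is
only multiplied by a sign. That sign is `+1` at level `r`, where twins must have equal lower sums,
and `-1` at level `r + 1`, where the two halves must cancel. -/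
theorem downSum_twist {n : ℕ} {F : Type*} [Field F] (r : ℕ) (f : (Fin n → ZMod 2) → ℕ → F)
    (x : Fin n → ZMod 2) (i : ℕ) :
    downSum (twist r f) x i = (-1) ^ (i + r) * downSum f (x + cubeUnit n r) i := by
  cases i with
  | zero => simp [downSum]
  | succ i =>
    simp only [downSum, twist, add_right_comm x (cubeUnit n i)]
    ring

theorem upSum_twist {n : ℕ} {F : Type*} [Field F] (r : ℕ) (f : (Fin n → ZMod 2) → ℕ → F)
    (x : Fin n → ZMod 2) (i : ℕ) :
    upSum (twist r f) x i = (-1) ^ (i + r) * upSum f (x + cubeUnit n r) i := by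
  simp only [upSum, twist, add_right_comm x (cubeUnit n i)]
  ring

/-- A function on level `r + 1` that balances the equations of level `r` for an open solution `f`
and its twist, with the values `c` prescribed on half of the level. -/
def topLayer {n : ℕ} {F : Type*} [Field F] (r : ℕ) (z : Fin n → ZMod 2)
    (f : (Fin n → ZMod 2) → ℕ → F) (c : (Fin n → ZMod 2) → F) : (Fin n → ZMod 2) → ℕ → F :=
  fun x i =>
    if i = r + 1 then
      if x ∈ subcube r z then c x
      else if x + cubeUnit n r ∈ subcube r z then
        -downSum f (x + cubeUnit n r) r - c (x + cubeUnit n r)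
      else 0
    else 0

theorem topLayer_of_ne {n : ℕ} {F : Type*} [Field F] {r i : ℕ} (hi : i ≠ r + 1)
    (z : Fin n → ZMod 2) (f : (Fin n → ZMod 2) → ℕ → F) (c : (Fin n → ZMod 2) → F)
    (x : Fin n → ZMod 2) : topLayer r z f c x i = 0 := if_neg hi

theorem downSum_topLayer {n : ℕ} {F : Type*} [Field F] {r i : ℕ} (hi : i ≤ r + 1)
    (z : Fin n → ZMod 2) (f : (Fin n → ZMod 2) → ℕ → F) (c : (Fin n → ZMod 2) → F)
    (x : Fin n → ZMod 2) : downSum (topLayer r z f c) x i = 0 := by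
  cases i with
  | zero => rfl
  | succ i =>
    simp only [downSum]
    rw [topLayer_of_ne (by omega), topLayer_of_ne (by omega), add_zero]

theorem upSum_topLayer_of_lt {n : ℕ} {F : Type*} [Field F] {r i : ℕ} (hi : i < r)
    (z : Fin n → ZMod 2) (f : (Fin n → ZMod 2) → ℕ → F) (c : (Fin n → ZMod 2) → F)
    (x : Fin n → ZMod 2) : upSum (topLayer r z f c) x i = 0 := by
  simp only [upSum]
  rw [topLayer_of_ne (by omega), topLayer_of_ne (by omega), add_zero]

theorem IsOpenSolution.downSum_top_eq_zero {n : ℕ} {F : Type*} [Field F] {r : ℕ}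
    {z : Fin n → ZMod 2} {f : (Fin n → ZMod 2) → ℕ → F} (hf : IsOpenSolution r z f)
    {x : Fin n → ZMod 2} (hx : x ∉ subcube r z) : downSum f x r = 0 := by
  cases r with
  | zero => rfl
  | succ r =>
    simp only [downSum]
    rw [hf.eq_zero _ _ (fun h => hx h.1),
      hf.eq_zero _ _ (fun h => hx ((add_cubeUnit_mem_subcube r.lt_succ_self).1 h.1)), add_zero]

theorem IsOpenSolution.upSum_top_eq_zero {n : ℕ} {F : Type*} [Field F] {r : ℕ}
    {z : Fin n → ZMod 2} {f : (Fin n → ZMod 2) → ℕ → F} (hf : IsOpenSolution r z f)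
    (x : Fin n → ZMod 2) : upSum f x r = 0 := by
  simp only [upSum]
  rw [hf.eq_zero _ _ (fun h => absurd h.2 (by omega)),
    hf.eq_zero _ _ (fun h => absurd h.2 (by omega)), add_zero]

/-- At most one of `x` and `x + cubeUnit n r` lies in `subcube r z`, so the right side has at most
one nonzero term and is the same for both twins, as their common upper neighbors require. -/
theorem upSum_topLayer {n : ℕ} {F : Type*} [Field F] {r : ℕ} (hr : r < n)
    {z : Fin n → ZMod 2} {f : (Fin n → ZMod 2) → ℕ → F} (hf : IsOpenSolution r z f)
    (c : (Fin n → ZMod 2) → F) (x : Fin n → ZMod 2) :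
    upSum (topLayer r z f c) x r = -(downSum f x r + downSum f (x + cubeUnit n r) r) := by
  by_cases hx : x ∈ subcube r z
  · have hx' := add_cubeUnit_notMem_subcube hr hx
    rw [hf.downSum_top_eq_zero hx']
    simp [upSum, topLayer, hx, hx', add_cubeUnit_cancel]
  · by_cases hx' : x + cubeUnit n r ∈ subcube r z
    · rw [hf.downSum_top_eq_zero hx]
      simp [upSum, topLayer, hx, hx']
    · rw [hf.downSum_top_eq_zero hx, hf.downSum_top_eq_zero hx']
      simp [upSum, topLayer, hx, hx', add_cubeUnit_cancel]

/-- An open solution on one half of a sub-butterfly with levels `0, …, r + 1`, extended to the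
whole of it. -/
def glue {n : ℕ} {F : Type*} [Field F] (r : ℕ) (z : Fin n → ZMod 2)
    (f g : (Fin n → ZMod 2) → ℕ → F) (c : (Fin n → ZMod 2) → F) : (Fin n → ZMod 2) → ℕ → F :=
  f + twist r f + g + topLayer r z f c

theorem glue_left {n : ℕ} {F : Type*} [Field F] {r : ℕ} (hr : r < n) {z : Fin n → ZMod 2}
    {f g : (Fin n → ZMod 2) → ℕ → F} (hf : IsOpenSolution r z f)
    (hg : IsOpenSolution r (z + cubeUnit n r) g) (c : (Fin n → ZMod 2) → F)
    {x : Fin n → ZMod 2} (hx : x ∈ subcube r z) {i : ℕ} (hi : i ≤ r) :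
    glue r z f g c x i = f x i := by
  have hx' := add_cubeUnit_notMem_subcube hr hx
  simp only [glue, Pi.add_apply, twist]
  rw [hf.eq_zero (x + _) i (fun h => hx' h.1),
    hg.eq_zero x i (fun h => hx' (mem_subcube_add_cubeUnit_right.1 h.1)),
    topLayer_of_ne (by omega)]
  ring

theorem glue_right {n : ℕ} {F : Type*} [Field F] {r : ℕ} (hr : r < n) {z : Fin n → ZMod 2}
    {f : (Fin n → ZMod 2) → ℕ → F} (hf : IsOpenSolution r z f)
    (g : (Fin n → ZMod 2) → ℕ → F) (c : (Fin n → ZMod 2) → F)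
    {x : Fin n → ZMod 2} (hx : x ∈ subcube r (z + cubeUnit n r)) {i : ℕ} (hi : i ≤ r) :
    glue r z f g c x i = twist r f x i + g x i := by
  have hx' : x ∉ subcube r z := fun h =>
    add_cubeUnit_notMem_subcube hr h (mem_subcube_add_cubeUnit_right.1 hx)
  simp only [glue, Pi.add_apply]
  rw [hf.eq_zero x i (fun h => hx' h.1), topLayer_of_ne (by omega)]
  ring

theorem glue_top {n : ℕ} {F : Type*} [Field F] {r : ℕ} {z : Fin n → ZMod 2}
    {f g : (Fin n → ZMod 2) → ℕ → F} (hf : IsOpenSolution r z f)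
    (hg : IsOpenSolution r (z + cubeUnit n r) g) (c : (Fin n → ZMod 2) → F)
    (x : Fin n → ZMod 2) : glue r z f g c x (r + 1) = topLayer r z f c x (r + 1) := by
  have hr : ¬ r + 1 ≤ r := by omega
  simp only [glue, Pi.add_apply, twist]
  rw [hf.eq_zero x _ (fun h => hr h.2), hf.eq_zero (x + _) _ (fun h => hr h.2),
    hg.eq_zero x _ (fun h => hr h.2)]
  ring

theorem downSum_glue {n : ℕ} {F : Type*} [Field F] {r i : ℕ} (hi : i ≤ r + 1)
    (z : Fin n → ZMod 2) (f g : (Fin n → ZMod 2) → ℕ → F) (c : (Fin n → ZMod 2) → F)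
    (x : Fin n → ZMod 2) : downSum (glue r z f g c) x i =
      downSum f x i + (-1) ^ (i + r) * downSum f (x + cubeUnit n r) i + downSum g x i := by
  rw [glue, downSum_add, downSum_add, downSum_add, downSum_twist, downSum_topLayer hi, add_zero]

/-- The lower sums of `f` and its twist at level `r` agree between twins and are balanced by
`topLayer`. Nothing is left to balance `g` there, which is why `g` must be a full solution. -/
theorem IsOpenSolution.glue {n : ℕ} {F : Type*} [Field F] {r : ℕ} (hr : r < n)
    {z : Fin n → ZMod 2} {f g : (Fin n → ZMod 2) → ℕ → F} (hf : IsOpenSolution r z f)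
    (hg : IsSolution r (z + cubeUnit n r) g) (c : (Fin n → ZMod 2) → F) :
    IsOpenSolution (r + 1) z (glue r z f g c) where
  eq_zero x i h := by
    rw [mem_subcube_succ hr] at h
    by_cases hi : i ≤ r + 1
    · have hx : x ∉ subcube r z := fun hx => h ⟨Or.inl hx, hi⟩
      have hx' : x + cubeUnit n r ∉ subcube r z := fun hx => h ⟨Or.inr hx, hi⟩
      simp only [_root_.glue, Pi.add_apply, twist, topLayer, hx, hx', if_false, ite_self]
      rw [hf.eq_zero x i (fun h => hx h.1), hf.eq_zero (x + _) i (fun h => hx' h.1),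
        hg.eq_zero x i (fun h => hx' (mem_subcube_add_cubeUnit_right.1 h.1))]
      ring
    · simp only [_root_.glue, Pi.add_apply, twist]
      rw [hf.eq_zero x i (fun h => by omega), hf.eq_zero (x + _) i (fun h => by omega),
        hg.eq_zero x i (fun h => by omega), topLayer_of_ne (by omega)]
      ring
  sum_eq_zero x i hi := by
    rw [downSum_glue (by omega), _root_.glue, upSum_add, upSum_add, upSum_add, upSum_twist]
    rcases (Nat.lt_succ_iff.1 hi).eq_or_lt with rfl | hi
    · rw [hf.upSum_top_eq_zero, hf.upSum_top_eq_zero, hg.upSum_top_eq_zero, hg.top_sum,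
        upSum_topLayer hr hf, Even.neg_one_pow ⟨i, rfl⟩]
      ring
    · rw [upSum_topLayer_of_lt hi]
      linear_combination hf.sum_eq_zero x i hi +
        (-1) ^ (i + r) * hf.sum_eq_zero (x + cubeUnit n r) i hi + hg.sum_eq_zero x i hi

/-- At level `r + 1` the values of `f` and its twist cancel, so only the values of `g` on level `r`
could violate the new equations; they are required to vanish. -/
theorem IsSolution.glue {n : ℕ} {F : Type*} [Field F] {r : ℕ} (hr : r < n)
    {z : Fin n → ZMod 2} {f g : (Fin n → ZMod 2) → ℕ → F} (hf : IsOpenSolution r z f)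
    (hg : IsZeroTopSolution r (z + cubeUnit n r) g) (c : (Fin n → ZMod 2) → F) :
    IsSolution (r + 1) z (glue r z f g c) where
  toIsOpenSolution := hf.glue hr hg.toIsSolution c
  top_sum x := by
    rw [downSum_glue le_rfl, Odd.neg_one_pow ⟨r, by ring⟩]
    simp only [downSum, hg.top_eq_zero, add_cubeUnit_cancel]
    ring

/-- With `c = 0`, the rest of `topLayer` consists of negated lower sums of `f` at level `r`, which
vanish because `f` is a full solution. -/
theorem IsZeroTopSolution.glue {n : ℕ} {F : Type*} [Field F] {r : ℕ} (hr : r < n)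
    {z : Fin n → ZMod 2} {f g : (Fin n → ZMod 2) → ℕ → F} (hf : IsSolution r z f)
    (hg : IsZeroTopSolution r (z + cubeUnit n r) g) :
    IsZeroTopSolution (r + 1) z (glue r z f g 0) where
  toIsSolution := IsSolution.glue hr hf.toIsOpenSolution hg 0
  top_eq_zero x := by
    rw [glue_top hf.toIsOpenSolution hg.toIsOpenSolution]
    simp [topLayer, hf.top_sum]

/-! ### Forcing, level by level -/

/-- The coloring rule of the butterfly network adds no vertex to `C`. Only the forces from `(x, i)`
or `(x, i + 1)` inside the two levels `i` and `i + 1` are listed. -/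
structure LevelClosed {n : ℕ} (C : (Fin n → ZMod 2) → ℕ → Prop) : Prop where
  up : ∀ x, ∀ i < n, C x i → (∀ j, j + 1 = i → C x j ∧ C (x + cubeUnit n j) j) →
    C x (i + 1) → C (x + cubeUnit n i) (i + 1)
  down : ∀ x, ∀ i < n, C x (i + 1) → C x (i + 2) → C (x + cubeUnit n (i + 1)) (i + 2) →
    C x i → C (x + cubeUnit n i) i

/-- `T` forces the sub-butterfly with levels `0, …, r` through `z` under the side condition `H`,
and every function on `T` extends to a solution of the type `P`. -/
structure IsSeed {n : ℕ} {F : Type*} [Field F] (r : ℕ) (z : Fin n → ZMod 2)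
    (P : ((Fin n → ZMod 2) → ℕ → F) → Prop) (H : ((Fin n → ZMod 2) → ℕ → Prop) → Prop)
    (T : Finset ((Fin n → ZMod 2) × ℕ)) : Prop where
  mem : ∀ p ∈ T, p.1 ∈ subcube r z ∧ p.2 ≤ r
  force : ∀ C, LevelClosed C → H C → (∀ p ∈ T, C p.1 p.2) → ∀ x ∈ subcube r z, ∀ i ≤ r, C x i
  extend : ∀ c : (Fin n → ZMod 2) → ℕ → F, ∃ f, P f ∧ ∀ p ∈ T, f p.1 p.2 = c p.1 p.2

/-- All upper neighbors of the top level `r` are colored. -/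
def UpperColored {n : ℕ} (r : ℕ) (z : Fin n → ZMod 2) (C : (Fin n → ZMod 2) → ℕ → Prop) : Prop :=
  ∀ x ∈ subcube r z, C x (r + 1) ∧ C (x + cubeUnit n r) (r + 1)

/-- All vertices of the top level `r` and all their upper neighbors are colored. -/
def TopColored {n : ℕ} (r : ℕ) (z : Fin n → ZMod 2) (C : (Fin n → ZMod 2) → ℕ → Prop) : Prop :=
  UpperColored r z C ∧ ∀ x ∈ subcube r z, C x r

/-- Half of level `r + 1`: one vertex of each pair of twins. -/
def halfLevel {n : ℕ} (r : ℕ) (z : Fin n → ZMod 2) : Finset ((Fin n → ZMod 2) × ℕ) :=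
  (subcube r z).map ⟨fun x => (x, r + 1), fun _ _ h => congrArg Prod.fst h⟩

theorem mem_halfLevel {n r : ℕ} {z : Fin n → ZMod 2} {p : (Fin n → ZMod 2) × ℕ} :
    p ∈ halfLevel r z ↔ p.1 ∈ subcube r z ∧ p.2 = r + 1 := by
  obtain ⟨x, i⟩ := p
  rw [halfLevel, Finset.mem_map]
  constructor
  · rintro ⟨y, hy, h⟩
    obtain ⟨rfl, rfl⟩ := Prod.mk.inj h
    exact ⟨hy, rfl⟩
  · rintro ⟨hx, rfl⟩
    exact ⟨x, hx, rfl⟩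

theorem forall_mem_subcube_succ {n r : ℕ} (hr : r < n) {z : Fin n → ZMod 2}
    {C : (Fin n → ZMod 2) → Prop} (h : ∀ x ∈ subcube r z, C x)
    (h' : ∀ x ∈ subcube r (z + cubeUnit n r), C x) : ∀ x ∈ subcube (r + 1) z, C x := by
  intro x hx
  rcases (mem_subcube_succ hr).1 hx with hx | hx
  · exact h x hx
  · exact h' x (mem_subcube_add_cubeUnit_right.2 hx)

theorem subcube_subset_succ {n r : ℕ} (hr : r < n) {z x : Fin n → ZMod 2}
    (hx : x ∈ subcube r z) : x ∈ subcube (r + 1) z := (mem_subcube_succ hr).2 (Or.inl hx)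

theorem subcube_add_subset_succ {n r : ℕ} (hr : r < n) {z x : Fin n → ZMod 2}
    (hx : x ∈ subcube r (z + cubeUnit n r)) : x ∈ subcube (r + 1) z :=
  (mem_subcube_succ hr).2 (Or.inr (mem_subcube_add_cubeUnit_right.1 hx))

/-- Once one half of the sub-butterfly and the half of level `r + 1` above it are colored, level
`r + 1` gets colored. -/
theorem LevelClosed.force_up {n r : ℕ} (hr : r < n) {z : Fin n → ZMod 2}
    {C : (Fin n → ZMod 2) → ℕ → Prop} (hC : LevelClosed C)
    (hlow : ∀ x ∈ subcube r z, ∀ i ≤ r, C x i) (htop : ∀ x ∈ subcube r z, C x (r + 1)) :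
    ∀ x ∈ subcube (r + 1) z, C x (r + 1) := by
  refine forall_mem_subcube_succ hr htop fun x hx => ?_
  rw [mem_subcube_add_cubeUnit_right] at hx
  rw [← add_cubeUnit_cancel x r]
  refine hC.up _ r hr (hlow _ hx r le_rfl) ?_ (htop _ hx)
  rintro j rfl
  exact ⟨hlow _ hx j (by omega),
    hlow _ ((add_cubeUnit_mem_subcube j.lt_succ_self).2 hx) j (by omega)⟩

/-- Colored twins on level `r + 1` carry the coloring of level `r` over to the other half. -/
theorem LevelClosed.force_down {n r : ℕ} (hr : r < n) {z : Fin n → ZMod 2}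
    {C : (Fin n → ZMod 2) → ℕ → Prop} (hC : LevelClosed C)
    (hlow : ∀ x ∈ subcube r z, C x r) (htop : TopColored (r + 1) z C) :
    TopColored r (z + cubeUnit n r) C := by
  refine ⟨fun x hx => ⟨htop.2 x (subcube_add_subset_succ hr hx), htop.2 _ ?_⟩, fun x hx => ?_⟩
  · exact (add_cubeUnit_mem_subcube r.lt_succ_self).2 (subcube_add_subset_succ hr hx)
  · rw [mem_subcube_add_cubeUnit_right] at hx
    have hx' := subcube_subset_succ hr hx
    rw [← add_cubeUnit_cancel x r]
    exact hC.down _ r hr (htop.2 _ hx') (htop.1 _ hx').1 (htop.1 _ hx').2 (hlow _ hx)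

/-! ### Recursive construction of seeds -/

/-- The common step for open solutions and for solutions: an open seed on one half, a seed on the
other half, and one of each pair of twins on the new level. -/
theorem IsSeed.union_halfLevel {n : ℕ} {F : Type*} [Field F] {r : ℕ} (hr : r < n)
    {z : Fin n → ZMod 2} {P P' : ((Fin n → ZMod 2) → ℕ → F) → Prop}
    {H H' : ((Fin n → ZMod 2) → ℕ → Prop) → Prop} {T T' : Finset ((Fin n → ZMod 2) × ℕ)}
    (hT : IsSeed (F := F) r z (IsOpenSolution r z) (fun _ => True) T)
    (hT' : IsSeed r (z + cubeUnit n r) P' H' T')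
    (hP' : ∀ g, P' g → IsOpenSolution r (z + cubeUnit n r) g)
    (hP : ∀ f g c, IsOpenSolution r z f → P' g → P (glue r z f g c))
    (hH : ∀ C, LevelClosed C → H C → (∀ x ∈ subcube r z, C x r) →
      (∀ x ∈ subcube (r + 1) z, C x (r + 1)) → H' C) :
    IsSeed (r + 1) z P H (T ∪ T' ∪ halfLevel r z) where
  mem p hp := by
    rw [Finset.mem_union, Finset.mem_union, mem_halfLevel] at hp
    rcases hp with (hp | hp) | hp
    · exact ⟨subcube_subset_succ hr (hT.mem p hp).1, by have := (hT.mem p hp).2; omega⟩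
    · exact ⟨subcube_add_subset_succ hr (hT'.mem p hp).1, by have := (hT'.mem p hp).2; omega⟩
    · exact ⟨subcube_subset_succ hr hp.1, hp.2.le⟩
  force C hC hHC hTC := by
    have hlow := hT.force C hC trivial fun p hp => hTC p (by simp [hp])
    have htop := hC.force_up hr hlow fun x hx =>
      hTC (x, r + 1) (by simp [mem_halfLevel, hx])
    have hother := hT'.force C hC (hH C hC hHC (fun x hx => hlow x hx r le_rfl) htop)
      fun p hp => hTC p (by simp [hp])
    intro x hx i hi
    rcases hi.eq_or_lt with rfl | hi
    · exact htop x hx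
    · exact forall_mem_subcube_succ (C := fun x => C x i) hr
        (fun x hx => hlow x hx i (by omega)) (fun x hx => hother x hx i (by omega)) x hx
  extend c := by
    obtain ⟨f, hf, hfc⟩ := hT.extend c
    -- On the other half the glued function is `twist r f + g`, so `g` has to supply the difference.
    obtain ⟨g, hg, hgc⟩ := hT'.extend (c - twist r f)
    refine ⟨glue r z f g fun x => c x (r + 1), hP f g _ hf hg, ?_⟩
    rintro ⟨x, i⟩ hp
    rw [Finset.mem_union, Finset.mem_union, mem_halfLevel] at hp
    rcases hp with (hp | hp) | ⟨hx, rfl⟩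
    · rw [glue_left hr hf (hP' g hg) _ (hT.mem _ hp).1 (hT.mem _ hp).2]
      exact hfc _ hp
    · rw [glue_right hr hf g _ (hT'.mem _ hp).1 (hT'.mem _ hp).2, hgc _ hp]
      simp
    · rw [glue_top hf (hP' g hg)]
      simp only at hx
      simp [topLayer, hx]

/-- The new level is colored by assumption and zero for the solutions, so it contributes no seed
vertices. It makes the first half `UpperColored`; once that half is colored,
`LevelClosed.force_down` makes the other half `TopColored`. -/
theorem IsSeed.union_zeroTop {n : ℕ} {F : Type*} [Field F] {r : ℕ} (hr : r < n)
    {z : Fin n → ZMod 2} {T T' : Finset ((Fin n → ZMod 2) × ℕ)}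
    (hT : IsSeed (F := F) r z (IsSolution r z) (UpperColored r z) T)
    (hT' : IsSeed (F := F) r (z + cubeUnit n r) (IsZeroTopSolution r (z + cubeUnit n r))
      (TopColored r (z + cubeUnit n r)) T') :
    IsSeed (F := F) (r + 1) z (IsZeroTopSolution (r + 1) z) (TopColored (r + 1) z) (T ∪ T') where
  mem p hp := by
    rw [Finset.mem_union] at hp
    rcases hp with hp | hp
    · exact ⟨subcube_subset_succ hr (hT.mem p hp).1, by have := (hT.mem p hp).2; omega⟩
    · exact ⟨subcube_add_subset_succ hr (hT'.mem p hp).1, by have := (hT'.mem p hp).2; omega⟩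
  force C hC hHC hTC := by
    have hlow := hT.force C hC
      (fun x hx => ⟨hHC.2 x (subcube_subset_succ hr hx),
        hHC.2 _ ((add_cubeUnit_mem_subcube r.lt_succ_self).2 (subcube_subset_succ hr hx))⟩)
      fun p hp => hTC p (by simp [hp])
    have hother := hT'.force C hC (hC.force_down hr (fun x hx => hlow x hx r le_rfl) hHC)
      fun p hp => hTC p (by simp [hp])
    intro x hx i hi
    rcases hi.eq_or_lt with rfl | hi
    · exact hHC.2 x hx
    · exact forall_mem_subcube_succ (C := fun x => C x i) hr
        (fun x hx => hlow x hx i (by omega)) (fun x hx => hother x hx i (by omega)) x hx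
  extend c := by
    obtain ⟨f, hf, hfc⟩ := hT.extend c
    obtain ⟨g, hg, hgc⟩ := hT'.extend (c - twist r f)
    refine ⟨glue r z f g 0, IsZeroTopSolution.glue hr hf hg, ?_⟩
    rintro ⟨x, i⟩ hp
    rcases Finset.mem_union.1 hp with hp | hp
    · rw [glue_left hr hf.toIsOpenSolution hg.toIsOpenSolution _ (hT.mem _ hp).1 (hT.mem _ hp).2]
      exact hfc _ hp
    · rw [glue_right hr hf.toIsOpenSolution g _ (hT'.mem _ hp).1 (hT'.mem _ hp).2, hgc _ hp]
      simp

theorem IsSeed.card_union {n : ℕ} {F : Type*} [Field F] {r : ℕ} (hr : r < n)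
    {z : Fin n → ZMod 2} {P P' : ((Fin n → ZMod 2) → ℕ → F) → Prop}
    {H H' : ((Fin n → ZMod 2) → ℕ → Prop) → Prop} {T T' : Finset ((Fin n → ZMod 2) × ℕ)}
    (hT : IsSeed r z P H T) (hT' : IsSeed r (z + cubeUnit n r) P' H' T') :
    (T ∪ T').card = T.card + T'.card := by
  refine Finset.card_union_of_disjoint (Finset.disjoint_left.2 fun p hp hp' => ?_)
  exact add_cubeUnit_notMem_subcube hr (hT.mem p hp).1
    (mem_subcube_add_cubeUnit_right.1 (hT'.mem p hp').1)

theorem IsSeed.card_union_halfLevel {n : ℕ} {F : Type*} [Field F] {r : ℕ} (hr : r < n)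
    {z : Fin n → ZMod 2} {P P' : ((Fin n → ZMod 2) → ℕ → F) → Prop}
    {H H' : ((Fin n → ZMod 2) → ℕ → Prop) → Prop} {T T' : Finset ((Fin n → ZMod 2) × ℕ)}
    (hT : IsSeed r z P H T) (hT' : IsSeed r (z + cubeUnit n r) P' H' T') :
    (T ∪ T' ∪ halfLevel r z).card = T.card + T'.card + 2 ^ r := by
  rw [Finset.card_union_of_disjoint, hT.card_union hr hT', halfLevel, Finset.card_map,
    card_subcube hr.le]
  refine Finset.disjoint_left.2 fun p hp hp' => ?_
  have h := (mem_halfLevel.1 hp').2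
  rcases Finset.mem_union.1 hp with hp | hp
  · have := (hT.mem p hp).2
    omega
  · have := (hT'.mem p hp).2
    omega

theorem isSeed_zero_singleton {n : ℕ} {F : Type*} [Field F] (z : Fin n → ZMod 2)
    (H : ((Fin n → ZMod 2) → ℕ → Prop) → Prop) :
    IsSeed (F := F) 0 z (IsSolution 0 z) H {(z, 0)} where
  mem p hp := by
    rw [Finset.mem_singleton] at hp
    subst hp
    exact ⟨mem_subcube_self z, le_rfl⟩
  force C _ _ hTC x hx i hi := by
    rw [subcube_zero, Finset.mem_singleton] at hx
    rw [hx, Nat.le_zero.1 hi]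
    exact hTC (z, 0) (Finset.mem_singleton_self _)
  extend c := by
    refine ⟨fun x i => if x = z ∧ i = 0 then c x i else 0, ⟨⟨fun x i h => if_neg ?_, ?_⟩, ?_⟩, ?_⟩
    · rintro ⟨rfl, rfl⟩
      exact h ⟨mem_subcube_self x, le_rfl⟩
    · intro x i hi
      omega
    · intro x
      rfl
    · simp

/-- The single vertex is both colored and zero by assumption. -/
theorem isSeed_zero_empty {n : ℕ} {F : Type*} [Field F] (z : Fin n → ZMod 2) :
    IsSeed (F := F) 0 z (IsZeroTopSolution 0 z) (TopColored 0 z) ∅ where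
  mem p hp := absurd hp (Finset.notMem_empty p)
  force C _ hHC _ x hx i hi := by
    rw [Nat.le_zero.1 hi]
    exact hHC.2 x hx
  extend c := by
    refine ⟨0, ⟨⟨⟨fun _ _ _ => rfl, fun x i hi => by omega⟩, fun x => rfl⟩, fun x => rfl⟩, ?_⟩
    simp

/-- The three claims need each other, on both halves: the step combines L with K, L with O, and K
with O. The cardinalities solve the resulting recurrences with initial values 1, 1, 0. -/
theorem exists_isSeed {n : ℕ} (F : Type*) [Field F] (r : ℕ) (hr : r ≤ n) :
    ∀ z : Fin n → ZMod 2,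
    (∃ T, IsSeed (F := F) r z (IsOpenSolution r z) (fun _ => True) T ∧
      9 * (T.card : ℤ) = (3 * r + 10) * 2 ^ r - (-1) ^ r) ∧
    (∃ T, IsSeed (F := F) r z (IsSolution r z) (UpperColored r z) T ∧
      9 * (T.card : ℤ) = (3 * r + 7) * 2 ^ r + 2 * (-1) ^ r) ∧
    (∃ T, IsSeed (F := F) r z (IsZeroTopSolution r z) (TopColored r z) T ∧
      9 * (T.card : ℤ) = (3 * r + 1) * 2 ^ r - (-1) ^ r) := by
  induction r with
  | zero =>
    intro z
    refine ⟨⟨{(z, 0)}, ?_, by simp⟩, ⟨{(z, 0)}, isSeed_zero_singleton z _, by simp⟩,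
      ⟨∅, isSeed_zero_empty z, by simp⟩⟩
    have h := isSeed_zero_singleton (F := F) z fun _ => True
    refine ⟨h.mem, h.force, fun c => ?_⟩
    obtain ⟨f, hf, hfc⟩ := h.extend c
    exact ⟨f, hf.toIsOpenSolution, hfc⟩
  | succ r ih =>
    intro z
    have hr' : r < n := hr
    obtain ⟨⟨TL, hTL, cL⟩, ⟨TK, hTK, cK⟩, -⟩ := ih hr'.le z
    obtain ⟨-, ⟨TK', hTK', cK'⟩, ⟨TO', hTO', cO'⟩⟩ := ih hr'.le (z + cubeUnit n r)
    refine ⟨⟨TL ∪ TK' ∪ halfLevel r z, ?_, ?_⟩, ⟨TL ∪ TO' ∪ halfLevel r z, ?_, ?_⟩,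
      ⟨TK ∪ TO', hTK.union_zeroTop hr' hTO', ?_⟩⟩
    -- The upper neighbors of level `r` of the other half lie on level `r + 1`, which is already
    -- colored.
    · refine hTL.union_halfLevel hr' hTK' (fun g hg => hg.toIsOpenSolution)
        (fun f g c hf hg => hf.glue hr' hg c) fun C hC _ _ htop x hx => ?_
      have hx' := subcube_add_subset_succ hr' hx
      exact ⟨htop _ hx', htop _ ((add_cubeUnit_mem_subcube r.lt_succ_self).2 hx')⟩
    · rw [hTL.card_union_halfLevel hr' hTK']
      push_cast
      rw [pow_succ, pow_succ]
      linear_combination cL + cK'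
    · exact hTL.union_halfLevel hr' hTO' (fun g hg => hg.toIsOpenSolution)
        (fun f g c hf hg => IsSolution.glue hr' hf hg c)
        fun C hC hup hlow htop => hC.force_down hr' hlow ⟨hup, htop⟩
    · rw [hTL.card_union_halfLevel hr' hTO']
      push_cast
      rw [pow_succ, pow_succ]
      linear_combination cL + cO'
    · rw [hTK.card_union hr' hTO']
      push_cast
      rw [pow_succ, pow_succ]
      linear_combination cK + cO'

/-! ### The butterfly network -/

theorem cubeUnit_eq_single {n : ℕ} (k : Fin n) : cubeUnit n k.val = Pi.single k 1 := by
  ext j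
  simp [cubeUnit, Pi.single_apply, Fin.ext_iff]

theorem add_cubeUnit_ne_self {n i : ℕ} (hi : i < n) (x : Fin n → ZMod 2) :
    x + cubeUnit n i ≠ x := by
  intro h
  have := congrFun h ⟨i, hi⟩
  simp [cubeUnit] at this

theorem butterflyUp_iff {n : ℕ} {p q : ButterflyVertex n} :
    ButterflyUp n p q ↔
      q.2.val = p.2.val + 1 ∧ (q.1 = p.1 ∨ q.1 = p.1 + cubeUnit n p.2.val) := by
  constructor
  · rintro ⟨k, hp, hq, h⟩
    rw [← cubeUnit_eq_single] at h
    rw [hp, hq]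
    exact ⟨rfl, h⟩
  · rintro ⟨hq, h⟩
    have hk : p.2.val < n := by have := q.2.2; omega
    refine ⟨⟨p.2.val, hk⟩, rfl, Fin.ext hq, ?_⟩
    rwa [← cubeUnit_eq_single]

theorem butterflyUp_mk_iff {n : ℕ} {x y : Fin n → ZMod 2} {i j : ℕ} {hi : i < n + 1}
    {hj : j < n + 1} : ButterflyUp n (x, ⟨i, hi⟩) (y, ⟨j, hj⟩) ↔
      j = i + 1 ∧ (y = x ∨ y = x + cubeUnit n i) := butterflyUp_iff

theorem sum_butterflyUp_right {n : ℕ} {F : Type*} [Field F] (f : (Fin n → ZMod 2) → ℕ → F)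
    (hf : ∀ x i, n < i → f x i = 0) (p : ButterflyVertex n) :
    ∑ q, (if ButterflyUp n p q then f q.1 q.2.val else 0) = upSum f p.1 p.2.val := by
  obtain ⟨x, i⟩ := p
  by_cases hi : i.val < n
  · have hset : (Finset.univ.filter fun q => ButterflyUp n (x, i) q) =
        {(x, ⟨i.val + 1, by omega⟩), (x + cubeUnit n i.val, ⟨i.val + 1, by omega⟩)} := by
      ext ⟨y, j⟩
      simp only [Finset.mem_filter, Finset.mem_univ, true_and, butterflyUp_iff, Finset.mem_insert,
        Finset.mem_singleton, Prod.mk.injEq, Fin.ext_iff]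
      tauto
    rw [← Finset.sum_filter, hset, Finset.sum_pair]
    · rfl
    · exact fun h => add_cubeUnit_ne_self hi x (congrArg Prod.fst h).symm
  -- On the top level `n` there are no upper neighbors, and `upSum` reads level `n + 1`, where `f`
  -- vanishes.
  · rw [upSum, hf _ _ (by simp only; omega), hf _ _ (by simp only; omega), add_zero]
    refine Finset.sum_eq_zero fun q _ => if_neg fun h => ?_
    have h1 := (butterflyUp_iff.1 h).1
    have h2 := q.2.2
    simp only at h1
    omega

theorem sum_butterflyUp_left {n : ℕ} {F : Type*} [Field F] (f : (Fin n → ZMod 2) → ℕ → F)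
    (p : ButterflyVertex n) :
    ∑ q, (if ButterflyUp n q p then f q.1 q.2.val else 0) = downSum f p.1 p.2.val := by
  obtain ⟨x, ⟨i, hi⟩⟩ := p
  cases i with
  | zero =>
    refine Finset.sum_eq_zero fun q _ => if_neg fun h => ?_
    have h1 := (butterflyUp_iff.1 h).1
    simp only at h1
    omega
  | succ i =>
    have hset : (Finset.univ.filter fun q => ButterflyUp n q (x, ⟨i + 1, hi⟩)) =
        {(x, ⟨i, by omega⟩), (x + cubeUnit n i, ⟨i, by omega⟩)} := by
      ext ⟨y, ⟨j, hj⟩⟩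
      simp only [Finset.mem_filter, Finset.mem_univ, true_and, butterflyUp_iff, Finset.mem_insert,
        Finset.mem_singleton, Prod.mk.injEq, Fin.mk.injEq, Nat.add_right_cancel_iff]
      constructor
      · rintro ⟨rfl, rfl | rfl⟩
        · exact Or.inl ⟨rfl, rfl⟩
        · exact Or.inr ⟨(add_cubeUnit_cancel y i).symm, rfl⟩
      · rintro (⟨rfl, rfl⟩ | ⟨rfl, rfl⟩)
        · exact ⟨rfl, Or.inl rfl⟩
        · exact ⟨rfl, Or.inr (add_cubeUnit_cancel x j).symm⟩
    rw [← Finset.sum_filter, hset, Finset.sum_pair]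
    · rfl
    · exact fun h => add_cubeUnit_ne_self (by omega) x (congrArg Prod.fst h).symm

theorem butterfly_adjMatrix_mulVec {n : ℕ} {F : Type*} [Field F]
    (f : (Fin n → ZMod 2) → ℕ → F) (hf : ∀ x i, n < i → f x i = 0) (p : ButterflyVertex n) :
    ((butterfly n).adjMatrix F).mulVec (fun q => f q.1 q.2.val) p =
      downSum f p.1 p.2.val + upSum f p.1 p.2.val := by
  rw [← sum_butterflyUp_right f hf, ← sum_butterflyUp_left, ← Finset.sum_add_distrib]
  refine Finset.sum_congr rfl fun q _ => ?_
  change (butterfly n).adjMatrix F p q * f q.1 q.2.val = _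
  rw [SimpleGraph.adjMatrix_apply]
  have hadj : (butterfly n).Adj p q ↔ ButterflyUp n p q ∨ ButterflyUp n q p := Iff.rfl
  by_cases h1 : ButterflyUp n p q
  · have h2 : ¬ ButterflyUp n q p := fun h2 => by
      have := (butterflyUp_iff.1 h1).1
      have := (butterflyUp_iff.1 h2).1
      omega
    simp [hadj, h1, h2]
  · by_cases h2 : ButterflyUp n q p <;> simp [hadj, h1, h2]

/-- The quantifier over `hi` makes the absent levels above `n` count as colored, so `down` also
covers forces from the top level `n`. -/
theorem ForcingClosed.levelClosed {n : ℕ} {C : Set (ButterflyVertex n)}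
    (hC : ForcingClosed (butterfly n) C) :
    LevelClosed fun (x : Fin n → ZMod 2) i => ∀ hi : i < n + 1, (x, ⟨i, hi⟩) ∈ C where
  up x i hi hxi hdown hup hi' := by
    refine hC (x, ⟨i, by omega⟩) (hxi _) _ (Or.inl (butterflyUp_iff.2 ⟨rfl, Or.inr rfl⟩)) ?_
    rintro ⟨y, ⟨j, hj⟩⟩ hadj hne
    rcases hadj with h | h
    · obtain ⟨rfl, rfl | rfl⟩ := butterflyUp_mk_iff.1 h
      · exact hup _
      · exact absurd rfl hne
    · obtain ⟨rfl, rfl | rfl⟩ := butterflyUp_mk_iff.1 h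
      · exact (hdown j rfl).1 _
      · have := (hdown j rfl).2 hj
        rwa [add_cubeUnit_cancel] at this
  down x i hi hxi hup hup' hdown hi' := by
    refine hC (x, ⟨i + 1, by omega⟩) (hxi _) _
      (Or.inr (butterflyUp_iff.2 ⟨rfl, Or.inr (add_cubeUnit_cancel x i).symm⟩)) ?_
    rintro ⟨y, ⟨j, hj⟩⟩ hadj hne
    rcases hadj with h | h
    · obtain ⟨rfl, rfl | rfl⟩ := butterflyUp_mk_iff.1 h
      · exact hup _
      · exact hup' _
    · obtain ⟨h1, h2⟩ := butterflyUp_mk_iff.1 h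
      obtain rfl : i = j := Nat.succ_injective h1
      rcases h2 with rfl | rfl
      · exact hdown _
      · exact absurd (by simp only [add_cubeUnit_cancel]) hne

/-- A zero-forcing set of the butterfly network on which every function extends to a kernel vector
of the adjacency matrix. -/
theorem exists_isZeroForcing_butterfly (n : ℕ) (F : Type*) [Field F] :
    ∃ S : Finset (ButterflyVertex n), IsZeroForcing (butterfly n) S ∧
      9 * (S.card : ℤ) = (3 * n + 7) * 2 ^ n + 2 * (-1) ^ n ∧
      ∀ c : ButterflyVertex n → F, ∃ f : ButterflyVertex n → F,
        ((butterfly n).adjMatrix F).mulVec f = 0 ∧ ∀ v ∈ S, f v = c v := by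
  obtain ⟨-, ⟨T, hT, hcard⟩, -⟩ := exists_isSeed F n le_rfl (0 : Fin n → ZMod 2)
  have hinj : Function.Injective
      fun p : ButterflyVertex n => ((p.1, p.2.val) : (Fin n → ZMod 2) × ℕ) := by
    rintro ⟨x, i⟩ ⟨y, j⟩ h
    obtain ⟨rfl, h⟩ := Prod.mk.inj h
    exact Prod.ext rfl (Fin.ext h)
  refine ⟨T.preimage _ hinj.injOn, isZeroForcing_of_closed fun C hC hS p => ?_, ?_, fun c => ?_⟩
  -- `UpperColored` at level `n` concerns only the absent level `n + 1`, so it holds vacuously.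
  · refine hT.force _ hC.levelClosed (fun x _ => ⟨fun h => ?_, fun h => ?_⟩)
      (fun q hq hi => hS _ (Finset.mem_preimage.2 hq)) p.1 (mem_subcube_of_le le_rfl _ _)
      p.2.val (by omega) p.2.2
    · omega
    · omega
  · rw [← hcard, Finset.card_preimage, Finset.filter_true_of_mem]
    exact fun q hq => ⟨(q.1, ⟨q.2, Nat.lt_succ_of_le (hT.mem q hq).2⟩), rfl⟩
  · obtain ⟨f, hf, hfc⟩ := hT.extend fun x i => if hi : i < n + 1 then c (x, ⟨i, hi⟩) else 0
    refine ⟨fun q => f q.1 q.2.val, ?_, fun v hv => ?_⟩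
    · ext p
      rw [butterfly_adjMatrix_mulVec f fun x i hi => hf.eq_zero x i fun h => by omega]
      rcases (Nat.lt_succ_iff.1 p.2.2).eq_or_lt with hi | hi
      · rw [hi, hf.top_sum, hf.upSum_top_eq_zero, add_zero, Pi.zero_apply]
      · exact hf.sum_eq_zero p.1 _ hi
    · exact (hfc _ (Finset.mem_preimage.1 hv)).trans (dif_pos v.2.2)

theorem theorem1 (r : ℕ) (hr : 1 ≤ r) (F : Type*) [Field F] :
    (minRank F (butterfly r) : ℚ) = 2 / 9 * ((3 * r + 1) * 2 ^ r - (-1) ^ r) ∧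
    ((butterfly r).adjMatrix F).rank = minRank F (butterfly r) ∧
    (minRank F (butterfly r) : ℚ) =
      Fintype.card (ButterflyVertex r) - zeroForcingNumber (butterfly r) ∧
    (zeroForcingNumber (butterfly r) : ℚ) = (r + 1) * 2 ^ r - minRank F (butterfly r) ∧
    (zeroForcingNumber (butterfly r) : ℚ) = 1 / 9 * ((3 * r + 7) * 2 ^ r + 2 * (-1) ^ r) := by
  obtain ⟨S, hS, hcard, hext⟩ := exists_isZeroForcing_butterfly r F
  have hZ := zeroForcingNumber_le hS
  have hlower := card_le_zeroForcingNumber_add_minRank F (butterfly r)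
  have hadj : minRank F (butterfly r) ≤ ((butterfly r).adjMatrix F).rank :=
    (minRank_isLeast F _).2 ⟨_, adjMatrix_mem_graphMatrices F _, rfl⟩
  have hupper := rank_add_card_le hext
  have hV : (Fintype.card (ButterflyVertex r) : ℚ) = (r + 1) * 2 ^ r := by
    simp [ButterflyVertex, mul_comm]
  -- The inequalities `hZ`, `hlower`, `hadj` and `hupper` form a closed cycle, so each is an
  -- equality.
  have hsum : (minRank F (butterfly r) : ℚ) + zeroForcingNumber (butterfly r) =
      Fintype.card (ButterflyVertex r) := by
    exact_mod_cast (by omega : minRank F (butterfly r) + zeroForcingNumber (butterfly r) =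
      Fintype.card (ButterflyVertex r))
  have hZS : zeroForcingNumber (butterfly r) = S.card := by omega
  have hcard' : 9 * (zeroForcingNumber (butterfly r) : ℚ) =
      (3 * r + 7) * 2 ^ r + 2 * (-1) ^ r := by
    rw [hZS]
    exact_mod_cast hcard
  rw [hV] at hsum
  refine ⟨?_, by omega, ?_, ?_, ?_⟩
  · linear_combination hsum - hcard' / 9
  · rw [hV]
    linear_combination hsum
  · linear_combination hsum
  · linear_combination hcard' / 9
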